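/- Let $X$ be a commutative hypergroup (in the sense of Dunkl, Jewett and Spector: a locally compact Hausdorff space with a convolution, identity $o$ and involution) and write $h(x*y)=\int_X h\,d(\delta_x*\delta_y)$ for continuous $h\colon X\to\mathbb{C}$. Let $\mathcal C(X)$ be the space of continuous functions $X\to\mathbb C$ with uniform convergence on compact sets. A variety is a closed linear subspace of $\mathcal C(X)$ that contains with each $h$ all its translates $x\mapsto h(x*y)$, $y\in X$; the variety $\tau(h)$ of $h$ is the smallest variety containing $h$. An exponential is a nonzero $m\in\mathcal C(X)$ with $m(x*y)=m(x)m(y)$ for all $x,y\in X$. A moment function sequence of rank $r\ge 1$ is a family $(f_\alpha)_{\alpha\in\mathbb{N}^r}$ in $\mathcal C(X)$ with $f_0\neq 0$ and $$f_\alpha(x*y)=\sum_{\beta\le\alpha}\binom{\alpha}{\beta}f_\beta(x)f_{\alpha-\beta}(y)\qquad(\alpha\in\mathbb{N}^r,\ x,y\in X);$$ with $m=f_0$, each $f_\alpha$ is called an $m$-moment function of order $|\alpha|$, and $m$ is its generating exponential. A function $f\in\mathcal C(X)$ is an exponential monomial if $\tau(f)$ is finite dimensional and is not the sum of two proper subvarieties.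 For an exponential $m$ let $(\Delta_{m;y}*f)(x)=f(x*y)-m(y)f(x)$ and $\Delta_{m;y_1,\dots,y_{k}}*f=\Delta_{m;y_1,\dots,y_{k-1}}*[\Delta_{m;y_{k}}*f]$. An exponential monomial $f$ is an $m$-exponential monomial if for some $n\in\mathbb{N}$ we have $\Delta_{m;y_1,\dots,y_{n+1}}*f=0$ for all $y_1,\dots,y_{n+1}\in X$; the smallest such $n$ is its degree (the zero function is included, with degree $0$). **Theorem.** Let $m,f\in\mathcal C(X)$ and let $f$ be an $m$-moment function of order $N$. 1. If $f\neq 0$, then $\tau(f)$ contains exactly one exponential, namely the generating exponential $m$. 2. $f$ is an $m$-exponential monomial of degree at most $N$. -/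

import Mathlib

open MeasureTheory Topology

/-- A (locally compact, Hausdorff) hypergroup in the sense of Dunkl, Jewett and Spector.  The
convolution of two point masses, `conv x y = δ_x * δ_y`, is a compactly supported Radon probability
measure; convolution extends to bounded regular measures by
`∫ h d(μ * ν) = ∫ ∫ (∫ h d(δ_x * δ_y)) dμ(x) dν(y)`, and associativity of this extension is
expressed by testing `(δ_x * δ_y) * δ_z = δ_x * (δ_y * δ_z)` on continuous functions. -/
class Hypergroup (X : Type*) [TopologicalSpace X] [T2Space X] [LocallyCompactSpace X]
    [MeasurableSpace X] [BorelSpace X] where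
  /-- the convolution `δ_x * δ_y` of two point masses -/
  conv : X → X → ProbabilityMeasure X
  /-- the identity `o` -/
  one : X
  /-- the involution -/
  inv : X → X
  regular_conv : ∀ x y, (conv x y : Measure X).Regular
  isCompact_support_conv : ∀ x y, IsCompact (conv x y : Measure X).support
  /-- `(x, y) ↦ δ_x * δ_y` is continuous for the weak topology of probability measures -/
  continuous_conv : Continuous fun p : X × X => conv p.1 p.2
  /-- `(x, y) ↦ supp (δ_x * δ_y)` is continuous for the Michael (Vietoris) topology on compact
  subsets -/
  continuous_support_conv : Continuous fun p : X × X =>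
    (⟨(conv p.1 p.2 : Measure X).support, isCompact_support_conv p.1 p.2⟩ :
      TopologicalSpace.Compacts X)
  conv_assoc : ∀ (h : C(X, ℂ)) (x y z : X),
    ∫ t, (∫ s, h s ∂(conv t z : Measure X)) ∂(conv x y : Measure X) =
      ∫ t, (∫ s, h s ∂(conv x t : Measure X)) ∂(conv y z : Measure X)
  one_conv : ∀ x, (conv one x : Measure X) = Measure.dirac x
  conv_one : ∀ x, (conv x one : Measure X) = Measure.dirac x
  continuous_inv : Continuous inv
  inv_inv : ∀ x, inv (inv x) = x
  map_inv_conv : ∀ x y,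
    (conv x y : Measure X).map inv = (conv (inv y) (inv x) : Measure X)
  one_mem_support_conv_iff : ∀ x y, one ∈ (conv x y : Measure X).support ↔ x = inv y

/-- A commutative hypergroup. -/
class CommHypergroup (X : Type*) [TopologicalSpace X] [T2Space X] [LocallyCompactSpace X]
    [MeasurableSpace X] [BorelSpace X] extends Hypergroup X where
  conv_comm : ∀ x y, conv x y = conv y x

namespace Hypergroup

section Translate

variable {X : Type*} [TopologicalSpace X] [T2Space X] [LocallyCompactSpace X]
  [MeasurableSpace X] [BorelSpace X] [Hypergroup X]

/-- `(x, y) ↦ h (x * y) = ∫ h d(δ_x * δ_y)` is continuous. -/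
theorem continuous_integral_conv (h : C(X, ℂ)) :
    Continuous fun p : X × X => ∫ t, h t ∂(conv p.1 p.2 : Measure X) := by
  rw [continuous_iff_continuousAt]
  intro p₀
  obtain ⟨L, hL, hsub⟩ := exists_compact_superset
    (isCompact_support_conv p₀.1 p₀.2 : IsCompact (conv p₀.1 p₀.2 : Measure X).support)
  obtain ⟨χ, hχ1, -, hχc, -⟩ := exists_continuous_one_zero_of_isCompact hL
    (isClosed_empty : IsClosed (∅ : Set X)) (Set.disjoint_empty L)
  have hcs : HasCompactSupport fun t => (χ t : ℂ) * h t := by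
    apply HasCompactSupport.mul_right
    exact hχc.comp_left (g := fun r : ℝ => (r : ℂ)) (by simp)
  have hcont : Continuous fun t => (χ t : ℂ) * h t := by fun_prop
  obtain ⟨C, hC⟩ := hcs.exists_bound_of_continuous hcont
  let g : BoundedContinuousFunction X ℂ :=
    BoundedContinuousFunction.ofNormedAddCommGroup _ hcont C hC
  have hlim := (ProbabilityMeasure.tendsto_iff_forall_integral_rclike_tendsto ℂ).1
    ((continuous_conv (X := X)).tendsto p₀) g
  have hev : ∀ᶠ p : X × X in 𝓝 p₀, (conv p.1 p.2 : Measure X).support ⊆ interior L := by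
    have hopen := (continuous_support_conv (X := X)).tendsto p₀
    have hmem : {K : TopologicalSpace.Compacts X | (K : Set X) ⊆ interior L} ∈
        𝓝 (⟨(conv p₀.1 p₀.2 : Measure X).support, isCompact_support_conv p₀.1 p₀.2⟩ :
          TopologicalSpace.Compacts X) :=
      (TopologicalSpace.Compacts.isOpen_subsets_of_isOpen isOpen_interior).mem_nhds hsub
    exact hopen hmem
  have heq : ∀ p : X × X, (conv p.1 p.2 : Measure X).support ⊆ interior L →
      ∫ t, g t ∂(conv p.1 p.2 : Measure X) = ∫ t, h t ∂(conv p.1 p.2 : Measure X) := by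
    intro p hp
    have := regular_conv p.1 p.2
    have hnull : (conv p.1 p.2 : Measure X) (conv p.1 p.2 : Measure X).supportᶜ = 0 :=
      Measure.measure_compl_support_of_innerRegularWRT_isCompact_isOpen
        Measure.Regular.innerRegular
    apply integral_congr_ae
    filter_upwards [show (conv p.1 p.2 : Measure X).support ∈ ae (conv p.1 p.2 : Measure X)
      from hnull] with t ht
    have h1 : χ t = 1 := hχ1 (interior_subset (hp ht))
    simp [g, h1]
  rw [ContinuousAt, ← heq p₀ hsub]
  exact hlim.congr' (hev.mono fun p hp => heq p hp)

/-- The translate of `h` by `y`: the function `x ↦ h (x * y) = ∫ h d(δ_x * δ_y)`. -/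
noncomputable def translate (y : X) (h : C(X, ℂ)) : C(X, ℂ) where
  toFun x := ∫ t, h t ∂(conv x y : Measure X)
  continuous_toFun := (continuous_integral_conv h).comp (by fun_prop : Continuous fun x => (x, y))

/-- A variety: a translation invariant linear subspace of `C(X, ℂ)` which is closed for uniform
convergence on compact sets (the compact-open topology of `C(X, ℂ)`). -/
def IsVariety (V : Submodule ℂ C(X, ℂ)) : Prop :=
  (∀ h ∈ V, ∀ y : X, translate y h ∈ V) ∧ IsClosed (V : Set C(X, ℂ))

/-- The variety `τ(h)` of `h`: the intersection of all varieties containing `h`. -/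
noncomputable def variety (h : C(X, ℂ)) : Submodule ℂ C(X, ℂ) :=
  sInf {V | IsVariety V ∧ h ∈ V}

/-- An exponential polynomial: a continuous function with finite dimensional variety. -/
def IsExponentialPolynomial (f : C(X, ℂ)) : Prop :=
  FiniteDimensional ℂ (variety f)

/-- An exponential monomial: an exponential polynomial whose variety is indecomposable, that is,
not the sum of two proper subvarieties. -/
def IsExponentialMonomial (f : C(X, ℂ)) : Prop :=
  IsExponentialPolynomial f ∧
    ¬ ∃ V W : Submodule ℂ C(X, ℂ), IsVariety V ∧ IsVariety W ∧
      V < variety f ∧ W < variety f ∧ V ⊔ W = variety f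

/-- An exponential: a non-identically zero continuous `m` with `m (x * y) = m x * m y`. -/
def IsExponential (m : C(X, ℂ)) : Prop :=
  m ≠ 0 ∧ ∀ x y : X, translate y m x = m x * m y

/-- The modified difference `Δ_{m;y} * f (x) = f (x * y) - m y * f x`. -/
noncomputable def modDiff (m : C(X, ℂ)) (y : X) (f : C(X, ℂ)) : C(X, ℂ) :=
  translate y f - m y • f

/-- The iterated modified difference
`Δ_{m; y₁, …, y_k} * f = Δ_{m; y₁, …, y_{k-1}} * [Δ_{m; y_k} * f]`. -/
noncomputable def iterModDiff (m : C(X, ℂ)) : (k : ℕ) → (Fin k → X) → C(X, ℂ) → C(X, ℂ)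
  | 0, _, f => f
  | k + 1, y, f => iterModDiff m k (fun i => y i.castSucc) (modDiff m (y (Fin.last k)) f)

/-- All modified differences `Δ_{m; y₁, …, y_{n+1}} * f` vanish. -/
def ModDiffVanish (m f : C(X, ℂ)) (n : ℕ) : Prop :=
  ∀ y : Fin (n + 1) → X, iterModDiff m (n + 1) y f = 0

/-- `f` is an `m`-exponential monomial: it is an exponential monomial, and `m` is an exponential
with `Δ_{m; y₁, …, y_{n+1}} * f = 0` identically for some `n`.  (The zero function is allowed.) -/
def IsExponentialMonomialFor (m f : C(X, ℂ)) : Prop :=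
  IsExponentialMonomial f ∧ IsExponential m ∧ ∃ n : ℕ, ModDiffVanish m f n

/-- The degree of an `m`-exponential monomial: the smallest `n` such that
`Δ_{m; y₁, …, y_{n+1}} * f = 0` identically. -/
noncomputable def expDegree (m f : C(X, ℂ)) : ℕ :=
  sInf {n : ℕ | ModDiffVanish m f n}

/-- A (generalized) moment function sequence of rank `r`, indexed by the multi-indices
`α : Fin r → ℕ`; `Finset.Iic α` is the set of all `β ≤ α`, and `∏ i, (α i).choose (β i)` is the
multi-index binomial coefficient. -/
def IsMomentSequence {r : ℕ} (F : (Fin r → ℕ) → C(X, ℂ)) : Prop :=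
  F 0 ≠ 0 ∧ ∀ (α : Fin r → ℕ) (x y : X),
    translate y (F α) x =
      ∑ β ∈ Finset.Iic α, ((∏ i, (α i).choose (β i) : ℕ) : ℂ) * F β x * F (α - β) y

/-- `f` is an `m`-moment function of order `N`: it is a member `F α` with `|α| = N` of a moment
function sequence `F` of some positive rank, generated by `F 0 = m`. -/
def IsMomentFunction (m : C(X, ℂ)) (N : ℕ) (f : C(X, ℂ)) : Prop :=
  ∃ r : ℕ, 0 < r ∧ ∃ F : (Fin r → ℕ) → C(X, ℂ), IsMomentSequence F ∧ F 0 = m ∧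
    ∃ α : Fin r → ℕ, ∑ i, α i = N ∧ F α = f

end Translate

end Hypergroup

/-!
The modified differences `Δ_{m;y} = T_y - m(y)` act nilpotently on the variety `τ(f)` of an
`m`-moment function `f`, and every assertion is a consequence of this nilpotency.

Let `(F_α)` be a moment sequence with `F_0 = m`. In the moment equation for `F_α` the term `β = α`
is `m(y) F_α(x)`, so `Δ_{m;y} F_α` is a combination of functions `F_β` with `β < α`, hence of
smaller order. Consequently the span `L_n` of the `F_β` with `|β| < n` is finite dimensional, so
closed, is translation invariant, and satisfies `Δ_{m;y} L_{n+1} ⊆ L_n` with `L_0 = 0`. If `f` has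
order `N`, then `τ(f) ⊆ L_{N+1}`, so `τ(f)` is finite dimensional and products of `N + 1` modified
differences vanish on it (`IsMomentSequence.iterate_diffSpan_variety`).

Write `I U` for the span of all `Δ_{m;y} g` with `g ∈ U` (`diffSpan m U`), and suppose that
`I^k τ(f) = 0` for some `k`.
* An exponential `m' ∈ τ(f)` satisfies `Δ_{m;y} m' = (m'(y) - m(y)) m'`, and nilpotency forces
  `m' = m` (`eq_of_iterate_diffSpan_eq_bot`). Conversely, if `f ≠ 0`, the last nonzero space
  `I^j τ(f)` consists of functions `g` with `g(x * y) = m(y) g(x)`; putting `x = o` shows that they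
  are multiples of `m`, so `m ∈ τ(f)` (`mem_of_iterate_diffSpan_eq_bot`).
* Any subspace between `I τ(f)` and `τ(f)` is translation invariant, so
  `τ(f) = ℂ f + I τ(f)` by minimality of `τ(f)` (`variety_le_span_sup_diffSpan`). By a
  Nakayama argument (`le_of_le_sup_diffSpan`) a subvariety `V` with `V + I τ(f) = τ(f)` is all of
  `τ(f)`. Hence every proper subvariety lies in `I τ(f)`, and so does the sum of two of them; but
  `I τ(f)` is a proper subspace when `τ(f) ≠ 0`.
-/

namespace Hypergroup

/-! ### Spans of families indexed by multi-indices -/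

namespace IsMomentSequence

variable {X : Type*} [TopologicalSpace X] {r : ℕ} {F : (Fin r → ℕ) → C(X, ℂ)}

/-- The span of the members of order less than `n` of a family indexed by multi-indices. -/
noncomputable def lowSpan (F : (Fin r → ℕ) → C(X, ℂ)) (n : ℕ) : Submodule ℂ C(X, ℂ) :=
  Submodule.span ℂ (F '' {β | ∑ i, β i < n})

theorem mem_lowSpan {n : ℕ} {β : Fin r → ℕ} (hβ : ∑ i, β i < n) : F β ∈ lowSpan F n :=
  Submodule.subset_span ⟨β, hβ, rfl⟩

theorem lowSpan_mono (F : (Fin r → ℕ) → C(X, ℂ)) : Monotone (lowSpan F) := fun _ _ h =>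
  Submodule.span_mono (Set.image_mono fun _ hβ => lt_of_lt_of_le hβ h)

theorem finiteDimensional_lowSpan (F : (Fin r → ℕ) → C(X, ℂ)) (n : ℕ) :
    FiniteDimensional ℂ (lowSpan F n) := by
  have hfin : {β : Fin r → ℕ | ∑ i, β i < n}.Finite := by
    refine (Set.finite_Iic fun _ : Fin r => n).subset fun β hβ i => ?_
    exact (Finset.single_le_sum (f := β) (fun _ _ => Nat.zero_le _) (Finset.mem_univ i)).trans
      (le_of_lt hβ)
  exact FiniteDimensional.span_of_finite ℂ (hfin.image F)

end IsMomentSequence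

variable {X : Type*} [TopologicalSpace X] [T2Space X] [LocallyCompactSpace X]
  [MeasurableSpace X] [BorelSpace X] [Hypergroup X]

/-! ### Translation as a linear operation -/

/-- Continuous functions are integrable because `δ_x * δ_y` is carried by its compact support. -/
theorem integrable_conv (h : C(X, ℂ)) (x y : X) :
    Integrable (fun t => h t) (conv x y : Measure X) := by
  have := regular_conv x y
  have hnull : (conv x y : Measure X) (conv x y : Measure X).supportᶜ = 0 :=
    Measure.measure_compl_support_of_innerRegularWRT_isCompact_isOpen
      Measure.Regular.innerRegular
  have h1 : IntegrableOn (fun t => h t) (conv x y : Measure X).support (conv x y : Measure X) :=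
    h.continuous.continuousOn.integrableOn_compact (isCompact_support_conv x y)
  have hres : (conv x y : Measure X).restrict (conv x y : Measure X).support = conv x y :=
    Measure.restrict_eq_self_of_ae_mem
      (show (conv x y : Measure X).support ∈ ae (conv x y : Measure X) from hnull)
  rwa [IntegrableOn, hres] at h1

theorem translate_apply (y : X) (h : C(X, ℂ)) (x : X) :
    translate y h x = ∫ t, h t ∂(conv x y : Measure X) := rfl

theorem translate_add (y : X) (g h : C(X, ℂ)) :
    translate y (g + h) = translate y g + translate y h := by
  ext x
  simpa [translate_apply] using integral_add (integrable_conv g x y) (integrable_conv h x y)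

theorem translate_smul (y : X) (c : ℂ) (h : C(X, ℂ)) :
    translate y (c • h) = c • translate y h := by
  ext x
  simpa [translate_apply] using integral_const_mul c fun t => h t

theorem translate_apply_one (y : X) (h : C(X, ℂ)) : translate y h one = h y := by
  rw [translate_apply, one_conv, integral_dirac]

/-- `translate y` as a linear map. -/
noncomputable def translateLinear (y : X) : C(X, ℂ) →ₗ[ℂ] C(X, ℂ) where
  toFun := translate y
  map_add' := translate_add y
  map_smul' := translate_smul y

/-- `modDiff m y` as a linear map. -/
noncomputable def modDiffLinear (m : C(X, ℂ)) (y : X) : C(X, ℂ) →ₗ[ℂ] C(X, ℂ) :=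
  translateLinear y - m y • LinearMap.id

theorem translate_eq_smul_add_modDiff (m : C(X, ℂ)) (y : X) (h : C(X, ℂ)) :
    translate y h = m y • h + modDiff m y h := by
  simp [modDiff]

/-! ### Varieties -/

theorem isVariety_of_finiteDimensional {V : Submodule ℂ C(X, ℂ)} [FiniteDimensional ℂ V]
    (hV : ∀ h ∈ V, ∀ y : X, translate y h ∈ V) : IsVariety V :=
  ⟨hV, V.closed_of_finiteDimensional⟩

theorem mem_variety_self (h : C(X, ℂ)) : h ∈ variety h := by
  simp only [variety, Submodule.mem_sInf]
  exact fun V hV => hV.2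

theorem variety_le {h : C(X, ℂ)} {V : Submodule ℂ C(X, ℂ)} (hV : IsVariety V) (hh : h ∈ V) :
    variety h ≤ V :=
  sInf_le ⟨hV, hh⟩

theorem translate_mem_variety {f h : C(X, ℂ)} (hh : h ∈ variety f) (y : X) :
    translate y h ∈ variety f := by
  simp only [variety, Submodule.mem_sInf] at hh ⊢
  exact fun V hV => hV.1.1 h (hh V hV) y

/-! ### The span of the modified differences of a subspace -/

/-- The span of all modified differences `Δ_{m;y} * g` with `g ∈ U` and `y ∈ X`. -/
noncomputable def diffSpan (m : C(X, ℂ)) (U : Submodule ℂ C(X, ℂ)) : Submodule ℂ C(X, ℂ) :=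
  ⨆ y : X, U.map (modDiffLinear m y)

variable {m : C(X, ℂ)} {U V : Submodule ℂ C(X, ℂ)}

theorem modDiff_mem_diffSpan {g : C(X, ℂ)} (hg : g ∈ U) (y : X) :
    modDiff m y g ∈ diffSpan m U :=
  Submodule.mem_iSup_of_mem y (Submodule.mem_map_of_mem (f := modDiffLinear m y) hg)

theorem diffSpan_le : diffSpan m U ≤ V ↔ ∀ g ∈ U, ∀ y : X, modDiff m y g ∈ V := by
  refine ⟨fun h g hg y => h (modDiff_mem_diffSpan hg y), fun h => iSup_le fun y => ?_⟩
  rintro _ ⟨g, hg, rfl⟩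
  exact h g hg y

theorem diffSpan_mono (m : C(X, ℂ)) : Monotone (diffSpan m) := fun _ _ h =>
  diffSpan_le.2 fun _ hg y => modDiff_mem_diffSpan (h hg) y

theorem diffSpan_sup : diffSpan m (U ⊔ V) = diffSpan m U ⊔ diffSpan m V := by
  simp only [diffSpan, Submodule.map_sup, iSup_sup_eq]

theorem diffSpan_le_self (hU : ∀ h ∈ U, ∀ y : X, translate y h ∈ U) : diffSpan m U ≤ U :=
  diffSpan_le.2 fun g hg y => U.sub_mem (hU g hg y) (U.smul_mem _ hg)

theorem iterate_diffSpan_le (hU : diffSpan m U ≤ U) (k : ℕ) : (diffSpan m)^[k] U ≤ U :=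
  (diffSpan_mono m).antitone_iterate_of_map_le hU (Nat.zero_le k)

theorem iterModDiff_mem_iterate_diffSpan (k : ℕ) (y : Fin k → X) {g : C(X, ℂ)} (hg : g ∈ U) :
    iterModDiff m k y g ∈ (diffSpan m)^[k] U := by
  induction k generalizing g U with
  | zero => exact hg
  | succ k ih => exact ih _ (modDiff_mem_diffSpan hg _)

/-- A subspace between `diffSpan m U` and `U` is translation invariant. -/
theorem translate_mem_of_diffSpan_le (hUV : diffSpan m U ≤ V) (hVU : V ≤ U) {h : C(X, ℂ)}
    (hh : h ∈ V) (y : X) : translate y h ∈ V := by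
  rw [translate_eq_smul_add_modDiff m]
  exact V.add_mem (V.smul_mem _ hh) (hUV (modDiff_mem_diffSpan (hVU hh) y))

/-- Nakayama's lemma for the nilpotent action of the modified differences. -/
theorem le_of_le_sup_diffSpan {k : ℕ} (hk : (diffSpan m)^[k] U = ⊥) (hV : diffSpan m V ≤ V)
    (h : U ≤ V ⊔ diffSpan m U) : U ≤ V := by
  have key : ∀ j, U ≤ V ⊔ (diffSpan m)^[j] U := by
    intro j
    induction j with
    | zero => exact le_sup_right
    | succ j ih =>
      rw [Function.iterate_succ_apply']
      refine h.trans (sup_le le_sup_left ((diffSpan_mono m ih).trans ?_))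
      rw [diffSpan_sup]
      exact sup_le_sup_right hV _
  simpa [hk] using key k

/-! ### Exponentials in a subspace with nilpotent modified differences -/

/-- An exponential `m'` is an eigenvector of `Δ_{m;y}` with eigenvalue `m'(y) - m(y)`, and a
nilpotent operator has no nonzero eigenvalue. -/
theorem eq_of_iterate_diffSpan_eq_bot {k : ℕ} (hk : (diffSpan m)^[k] U = ⊥) {m' : C(X, ℂ)}
    (hm' : IsExponential m') (hmem : m' ∈ U) : m' = m := by
  ext y
  by_contra hy
  have hdiff : modDiff m y m' = (m' y - m y) • m' := by
    ext x
    simp [modDiff, hm'.2 x y]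
    ring
  have key : ∀ j, m' ∈ (diffSpan m)^[j] U := by
    intro j
    induction j with
    | zero => exact hmem
    | succ j ih =>
      rw [Function.iterate_succ_apply']
      have h := modDiff_mem_diffSpan (m := m) ih y
      rwa [hdiff, Submodule.smul_mem_iff _ (sub_ne_zero.2 hy)] at h
  exact hm'.1 (by simpa [hk] using key k)

/-- A nonzero function annihilated by all modified differences is a multiple of `m`, and
nilpotency provides one in `U`. -/
theorem mem_of_iterate_diffSpan_eq_bot {k : ℕ} (hk : (diffSpan m)^[k] U = ⊥)
    (hU : diffSpan m U ≤ U) (hne : U ≠ ⊥) : m ∈ U := by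
  classical
  have hex : ∃ k, (diffSpan m)^[k] U = ⊥ := ⟨k, hk⟩
  -- `j + 1` is the least exponent that annihilates `U`; a nonzero `g` in the `j`-th iterate is
  -- then killed by all modified differences.
  obtain ⟨j, hj⟩ : ∃ j, Nat.find hex = j + 1 :=
    Nat.exists_eq_succ_of_ne_zero fun h0 => hne (by simpa [h0] using Nat.find_spec hex)
  have hbot : (diffSpan m)^[j + 1] U = ⊥ := hj ▸ Nat.find_spec hex
  obtain ⟨g, hg, hg0⟩ :=
    Submodule.exists_mem_ne_zero_of_ne_bot (Nat.find_min hex (m := j) (by omega))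
  rw [Function.iterate_succ_apply'] at hbot
  have hgy : ∀ y, g y = m y * g one := by
    intro y
    have h := modDiff_mem_diffSpan (m := m) hg y
    rw [hbot, Submodule.mem_bot] at h
    have h1 := DFunLike.congr_fun h one
    simpa [modDiff, translate_apply_one, sub_eq_zero] using h1
  have hgm : g = g one • m := by
    ext y
    simpa [mul_comm] using hgy y
  have hc : g one ≠ 0 := fun h => hg0 (ContinuousMap.ext fun y => by simpa [h] using hgy y)
  have hgU := iterate_diffSpan_le hU j hg
  rwa [hgm, Submodule.smul_mem_iff _ hc] at hgU

/-! ### Indecomposability -/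

theorem diffSpan_variety_le (m f : C(X, ℂ)) : diffSpan m (variety f) ≤ variety f :=
  diffSpan_le_self fun _ hh y => translate_mem_variety hh y

theorem variety_le_span_sup_diffSpan (m : C(X, ℂ)) {f : C(X, ℂ)}
    [FiniteDimensional ℂ (variety f)] :
    variety f ≤ Submodule.span ℂ {f} ⊔ diffSpan m (variety f) := by
  have hle : Submodule.span ℂ {f} ⊔ diffSpan m (variety f) ≤ variety f :=
    sup_le ((Submodule.span_singleton_le_iff_mem _ _).2 (mem_variety_self f))
      (diffSpan_variety_le m f)
  have := Submodule.finiteDimensional_of_le hle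
  have hge : diffSpan m (variety f) ≤ Submodule.span ℂ {f} ⊔ diffSpan m (variety f) :=
    le_sup_right
  have hvar : IsVariety (Submodule.span ℂ {f} ⊔ diffSpan m (variety f)) :=
    isVariety_of_finiteDimensional fun _ hh y => translate_mem_of_diffSpan_le hge hle hh y
  exact variety_le hvar (Submodule.mem_sup_left (Submodule.mem_span_singleton_self f))

/-- The span of the modified differences of `τ(f)` contains every proper subvariety of `τ(f)`. -/
theorem le_diffSpan_variety_of_lt {f : C(X, ℂ)} [FiniteDimensional ℂ (variety f)] {k : ℕ}
    (hk : (diffSpan m)^[k] (variety f) = ⊥) (hV : IsVariety V) (hlt : V < variety f) :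
    V ≤ diffSpan m (variety f) := by
  intro v hv
  obtain ⟨a, ha, b, hb, rfl⟩ :=
    Submodule.mem_sup.1 (variety_le_span_sup_diffSpan m (hlt.le hv))
  obtain ⟨c, rfl⟩ := Submodule.mem_span_singleton.1 ha
  rcases eq_or_ne c 0 with rfl | hc
  · simpa using hb
  -- If `c ≠ 0`, then `f ∈ V + I τ(f)`, and Nakayama's lemma gives `V = τ(f)`.
  · exfalso
    have hf : f ∈ V ⊔ diffSpan m (variety f) := by
      rw [← Submodule.smul_mem_iff _ hc, ← add_sub_cancel_right (c • f) b]
      exact Submodule.sub_mem _ (Submodule.mem_sup_left hv) (Submodule.mem_sup_right hb)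
    refine hlt.not_ge (le_of_le_sup_diffSpan hk (diffSpan_le_self hV.1) ?_)
    exact (variety_le_span_sup_diffSpan m).trans
      (sup_le ((Submodule.span_singleton_le_iff_mem _ _).2 hf) le_sup_right)

theorem isExponentialMonomial_of_iterate_diffSpan_eq_bot {f : C(X, ℂ)}
    [hfd : FiniteDimensional ℂ (variety f)] {k : ℕ}
    (hk : (diffSpan m)^[k] (variety f) = ⊥) : IsExponentialMonomial f := by
  refine ⟨hfd, ?_⟩
  rintro ⟨V, W, hV, hW, hVlt, hWlt, hsup⟩
  have hle : variety f ≤ diffSpan m (variety f) :=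
    hsup.ge.trans (sup_le (le_diffSpan_variety_of_lt hk hV hVlt)
      (le_diffSpan_variety_of_lt hk hW hWlt))
  have hV' : variety f ≤ V :=
    le_of_le_sup_diffSpan hk (diffSpan_le_self hV.1) (hle.trans le_sup_right)
  exact hVlt.not_ge hV'

/-! ### Moment sequences -/

namespace IsMomentSequence

variable {r : ℕ} {F : (Fin r → ℕ) → C(X, ℂ)}

theorem isExponential (hF : IsMomentSequence F) : IsExponential (F 0) := by
  refine ⟨hF.1, fun x y => ?_⟩
  have h : Finset.Iic (0 : Fin r → ℕ) = {0} := by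
    ext β
    simp
  simpa [h] using hF.2 0 x y

theorem modDiff_eq_sum (hF : IsMomentSequence F) (α : Fin r → ℕ) (y : X) :
    modDiff (F 0) y (F α) =
      ∑ β ∈ Finset.Iio α, (((∏ i, (α i).choose (β i) : ℕ) : ℂ) * F (α - β) y) • F β := by
  ext x
  have h := hF.2 α x y
  rw [← Finset.Iio_insert, Finset.sum_insert (by simp)] at h
  simp only [modDiff, ContinuousMap.sub_apply, ContinuousMap.smul_apply, h,
    ContinuousMap.sum_apply, smul_eq_mul]
  simp only [Nat.choose_self, Finset.prod_const_one, Nat.cast_one, one_mul, tsub_self]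
  rw [mul_comm (F α x), add_sub_cancel_left]
  exact Finset.sum_congr rfl fun β _ => by ring

theorem diffSpan_lowSpan_le (hF : IsMomentSequence F) (n : ℕ) :
    diffSpan (F 0) (lowSpan F (n + 1)) ≤ lowSpan F n := by
  refine iSup_le fun y => Submodule.map_le_iff_le_comap.2 (Submodule.span_le.2 ?_)
  rintro _ ⟨α, hα, rfl⟩
  change modDiff (F 0) y (F α) ∈ lowSpan F n
  rw [hF.modDiff_eq_sum]
  refine Submodule.sum_mem _ fun β hβ => Submodule.smul_mem _ _ (mem_lowSpan ?_)
  have hlt : ∑ i, β i < ∑ i, α i := Fintype.sum_strictMono (Finset.mem_Iio.1 hβ)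
  exact lt_of_lt_of_le hlt (Nat.lt_succ_iff.1 hα)

theorem iterate_diffSpan_lowSpan (hF : IsMomentSequence F) (n : ℕ) :
    (diffSpan (F 0))^[n] (lowSpan F n) = ⊥ := by
  induction n with
  | zero => simp [lowSpan]
  | succ n ih =>
    rw [Function.iterate_succ_apply, eq_bot_iff, ← ih]
    exact (diffSpan_mono (F 0)).iterate n (hF.diffSpan_lowSpan_le n)

theorem variety_le_lowSpan (hF : IsMomentSequence F) (α : Fin r → ℕ) :
    variety (F α) ≤ lowSpan F (∑ i, α i + 1) := by
  have := finiteDimensional_lowSpan F (∑ i, α i + 1)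
  refine variety_le (isVariety_of_finiteDimensional fun h hh y => ?_)
    (mem_lowSpan (Nat.lt_succ_self _))
  exact translate_mem_of_diffSpan_le (m := F 0)
    ((hF.diffSpan_lowSpan_le _).trans (lowSpan_mono F (Nat.le_succ _))) le_rfl hh y

theorem iterate_diffSpan_variety (hF : IsMomentSequence F) (α : Fin r → ℕ) :
    (diffSpan (F 0))^[∑ i, α i + 1] (variety (F α)) = ⊥ := by
  rw [eq_bot_iff, ← hF.iterate_diffSpan_lowSpan (∑ i, α i + 1)]
  exact (diffSpan_mono (F 0)).iterate _ (hF.variety_le_lowSpan α)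

end IsMomentSequence

end Hypergroup

theorem theorem1p2 {X : Type*} [TopologicalSpace X] [T2Space X] [LocallyCompactSpace X]
    [MeasurableSpace X] [BorelSpace X] [CommHypergroup X]
    (m f : C(X, ℂ)) (N : ℕ) (hf : Hypergroup.IsMomentFunction m N f) :
    (f ≠ 0 → ∀ m' : C(X, ℂ),
      (Hypergroup.IsExponential m' ∧ m' ∈ Hypergroup.variety f) ↔ m' = m) ∧
    Hypergroup.IsExponentialMonomialFor m f ∧ Hypergroup.expDegree m f ≤ N := by
  obtain ⟨r, -, F, hF, rfl, α, rfl, rfl⟩ := hf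
  have hnil := hF.iterate_diffSpan_variety α
  have := Hypergroup.IsMomentSequence.finiteDimensional_lowSpan F (∑ i, α i + 1)
  have := Submodule.finiteDimensional_of_le (hF.variety_le_lowSpan α)
  have hvan : Hypergroup.ModDiffVanish (F 0) (F α) (∑ i, α i) := fun y => by
    have h := Hypergroup.iterModDiff_mem_iterate_diffSpan (m := F 0) _ y
      (Hypergroup.mem_variety_self (F α))
    rwa [hnil, Submodule.mem_bot] at h
  refine ⟨fun hne m' => ⟨fun h => ?_, ?_⟩, ⟨?_, hF.isExponential, _, hvan⟩, Nat.sInf_le hvan⟩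
  · exact Hypergroup.eq_of_iterate_diffSpan_eq_bot hnil h.1 h.2
  · rintro rfl
    refine ⟨hF.isExponential, Hypergroup.mem_of_iterate_diffSpan_eq_bot hnil
      (Hypergroup.diffSpan_variety_le _ _) fun h => hne ?_⟩
    simpa [h] using Hypergroup.mem_variety_self (F α)
  · exact Hypergroup.isExponentialMonomial_of_iterate_diffSpan_eq_bot hnil
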